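/- Let $q$ be a prime power and $\mathbb{F}_q$ the field with $q$ elements. An $[n,k]_q$ code is a $k$-dimensional linear subspace $C$ of $\mathbb{F}_q^n$; the support of $c\in C$ is $\sigma(c)=\{i : c_i\neq 0\}$. The code $C$ is called minimal if for all codewords $c,c'\in C$ with $\sigma(c')\subseteq\sigma(c)$ the word $c'$ is a scalar multiple of $c$. Let $m(k,q)$ denote the smallest $n$ for which a minimal $[n,k]_q$ code exists. Then such codes exist in the cases below, and the following bounds hold. If $q>2$, then for every integer $k\ge 2$ $$m(k,q)\;\le\;\left\lceil \frac{2}{1+\frac{1}{(q+1)^2\ln q}}\,(k-1)\right\rceil (q+1).$$ If $q=2$, then for every integer $k\ge 1$ $$m(k,2)\;\le\;\frac{2k-1}{\log_2\left(\frac43\right)}.$$ -/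

import Mathlib

/-- A codeword `c` of a linear code `C ⊆ Fⁿ` is minimal if its support does not contain the
support of any codeword other than the scalar multiples of `c`. -/
def IsMinimalCodeword {F : Type*} [Field F] {n : ℕ} (C : Submodule F (Fin n → F))
    (c : Fin n → F) : Prop :=
  c ∈ C ∧ ∀ c' ∈ C, Function.support c' ⊆ Function.support c → ∃ a : F, c' = a • c

/-- A linear code is minimal if all its codewords are minimal. -/
def IsMinimalCode {F : Type*} [Field F] {n : ℕ} (C : Submodule F (Fin n → F)) : Prop :=
  ∀ c ∈ C, IsMinimalCodeword C c

/-- The set of all lengths `n` of minimal `[n, k]` codes over `F`, i.e. of minimal codes that are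
`k`-dimensional linear subspaces of `Fⁿ`. -/
def minimalCodeLengths (F : Type*) [Field F] (k : ℕ) : Set ℕ :=
  {n | ∃ C : Submodule F (Fin n → F), Module.finrank F C = k ∧ IsMinimalCode C}

/-- `m(k, q)`: the minimal length of a minimal `[n, k]` code over the field `F` of order `q`. -/
noncomputable def minLength (F : Type*) [Field F] (k : ℕ) : ℕ :=
  sInf (minimalCodeLengths F k)

/-! Evaluating functionals at vectors `P i` gives a minimal code once every independent pair `x, y`
has some `P i` killed by `x` but not by `y` (`card_mem_minimalCodeLengths`). The vectors are chosen
greedily by averaging (`exists_choices_card_filter_le`), each choice cutting the number of unserved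
pairs by a fixed factor. The count need not drop below one, since unserved pairs come in orbits
under `(x, y) ↦ (s • x, r • y + t • x)`.

For `q > 2` the choices are whole lines, and fewer than `(q - 1)² q` unserved pairs means none. For
`q = 2` they are single points; fewer than four unserved pairs means at most one orbit, of size two,
which one extra point repairs. -/

/-- If every `x ∈ X` fails for at most a proportion `c` of the choices `ω : Ω`, then `m` choices can
be made such that at most `c ^ m * #X` elements of `X` fail for all of them. -/
theorem exists_choices_card_filter_le {α Ω : Type*} [Fintype Ω] [Nonempty Ω]
    (fail : α → Ω → Prop) [∀ x ω, Decidable (fail x ω)] (X : Finset α) {c : ℝ} (hc : 0 ≤ c)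
    (h : ∀ x ∈ X, ((Finset.univ.filter fun ω => fail x ω).card : ℝ) ≤ c * Fintype.card Ω) (m : ℕ) :
    ∃ w : Fin m → Ω, ((X.filter fun x => ∀ i, fail x (w i)).card : ℝ) ≤ c ^ m * X.card := by
  induction m with
  | zero =>
    refine ⟨Fin.elim0, ?_⟩
    simp
  | succ m ih =>
    obtain ⟨w, hw⟩ := ih
    set Y := X.filter fun x => ∀ i, fail x (w i) with hY
    have hsum : ∑ ω : Ω, ((Y.filter fun x => fail x ω).card : ℝ) ≤ ∑ _ω : Ω, c * Y.card := by
      have hswap : ∑ ω : Ω, ((Y.filter fun x => fail x ω).card : ℝ)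
          = ∑ x ∈ Y, ((Finset.univ.filter fun ω => fail x ω).card : ℝ) := by
        simp_rw [Finset.card_filter, Nat.cast_sum]
        rw [Finset.sum_comm]
      rw [hswap]
      calc ∑ x ∈ Y, ((Finset.univ.filter fun ω => fail x ω).card : ℝ)
          ≤ ∑ x ∈ Y, c * Fintype.card Ω :=
            Finset.sum_le_sum fun x hx => h x (Finset.mem_filter.1 hx).1
        _ = ∑ _ω : Ω, c * Y.card := by
            simp only [Finset.sum_const, nsmul_eq_mul, Finset.card_univ]; ring
    obtain ⟨ω, -, hω⟩ := Finset.exists_le_of_sum_le Finset.univ_nonempty hsum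
    refine ⟨Fin.cons ω w, ?_⟩
    have hset : (X.filter fun x => ∀ i, fail x ((Fin.cons ω w : Fin (m + 1) → Ω) i))
        = Y.filter fun x => fail x ω := by
      ext x
      simp only [hY, Finset.mem_filter, Fin.forall_fin_succ, Fin.cons_zero, Fin.cons_succ]
      tauto
    rw [hset, pow_succ']
    calc _ ≤ c * (Y.card : ℝ) := hω
      _ ≤ c * (c ^ m * X.card) := by gcongr
      _ = _ := by ring

/-- The fibres of a surjective homomorphism of finite groups all have the same size. -/
theorem card_filter_map_mem_mul_card {A B : Type*} [AddGroup A] [AddGroup B] [Fintype A]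
    [Fintype B] [DecidableEq B] (f : A →+ B) (hf : Function.Surjective f) (S : Finset B) :
    (Finset.univ.filter fun a => f a ∈ S).card * Fintype.card B = S.card * Fintype.card A := by
  have hfib : ∀ b : B, (Finset.univ.filter fun a => f a = b).card
      = (Finset.univ.filter fun a => f a = 0).card := fun b =>
    AddMonoidHom.card_fiber_eq_of_mem_range f (hf b) (hf 0)
  have hcount : ∀ T : Finset B, (Finset.univ.filter fun a => f a ∈ T).card
      = T.card * (Finset.univ.filter fun a => f a = 0).card := by
    intro T
    rw [Finset.card_eq_sum_card_fiberwise (f := f) (t := T) (fun a ha => by simpa using ha),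
      Finset.sum_const_nat]
    intro b hb
    rw [← hfib b, Finset.filter_filter]
    congr 1
    ext a
    simp only [Finset.mem_filter, Finset.mem_univ, true_and]
    constructor
    · exact fun h => h.2
    · rintro rfl; exact ⟨hb, rfl⟩
  have huniv := hcount Finset.univ
  simp only [Finset.mem_univ, Finset.filter_true, Finset.card_univ] at huniv
  rw [hcount, huniv]
  ring

/-- The pairing with a linearly independent pair of vectors. -/
def dotProductPair {F : Type*} [Field F] {k : ℕ} (x y : Fin k → F) : (Fin k → F) →+ F × F where
  toFun P := (x ⬝ᵥ P, y ⬝ᵥ P)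
  map_zero' := by simp
  map_add' P Q := by simp [dotProduct_add]

theorem dotProductPair_surjective {F : Type*} [Field F] {k : ℕ} {x y : Fin k → F}
    (h : LinearIndependent F ![x, y]) : Function.Surjective (dotProductPair x y) := by
  have hrank : (Matrix.of ![x, y]).rank = 2 := by
    simpa using LinearIndependent.rank_matrix (M := Matrix.of ![x, y]) h
  have hsurj : Function.Surjective (Matrix.of ![x, y]).mulVecLin := by
    rw [← LinearMap.range_eq_top]
    exact Submodule.eq_top_of_finrank_eq (by rw [← Matrix.rank, hrank]; simp)
  rintro ⟨a, b⟩
  obtain ⟨P, hP⟩ := hsurj ![a, b]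
  refine ⟨P, ?_⟩
  have h0 := congrFun hP 0
  have h1 := congrFun hP 1
  simp [Matrix.mulVec] at h0 h1
  simp [dotProductPair, h0, h1]

/-- A vector configuration such that for any two independent functionals `x, y` some vector is
killed by `x` but not by `y` yields a minimal code. -/
theorem card_mem_minimalCodeLengths {F : Type*} [Field F] {k : ℕ} (hk : 2 ≤ k) {ι : Type*}
    [Fintype ι] (P : ι → Fin k → F)
    (hP : ∀ x y : Fin k → F, LinearIndependent F ![x, y] → ∃ i, x ⬝ᵥ P i = 0 ∧ y ⬝ᵥ P i ≠ 0) :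
    Fintype.card ι ∈ minimalCodeLengths F k := by
  let e := Fintype.equivFin ι
  let f : (Fin k → F) →ₗ[F] (Fin (Fintype.card ι) → F) :=
    { toFun := fun x i => x ⬝ᵥ P (e.symm i)
      map_add' := fun x y => by ext i; simp [add_dotProduct]
      map_smul' := fun a x => by ext i; simp [smul_dotProduct] }
  have hf : Function.Injective f := by
    rw [injective_iff_map_eq_zero]
    intro y hy
    by_contra hy0
    -- Any independent partner `x` produces a point where `y` is nonzero; this is where `2 ≤ k` is
    -- needed.
    obtain ⟨x, hx⟩ : ∃ x, LinearIndependent F ![y, x] :=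
      exists_linearIndependent_pair_of_one_lt_finrank (by simpa using Nat.lt_of_succ_le hk) hy0
    obtain ⟨i, -, hi⟩ := hP x y (LinearIndependent.pair_symm_iff.1 hx)
    apply hi
    simpa [f] using congrFun hy (e i)
  refine ⟨LinearMap.range f, ?_, ?_⟩
  · rw [LinearMap.finrank_range_of_inj hf]; simp
  · rintro _ ⟨x, rfl⟩
    refine ⟨⟨x, rfl⟩, ?_⟩
    rintro _ ⟨y, rfl⟩ hsupp
    by_cases hx : x = 0
    · subst hx
      refine ⟨0, ?_⟩
      simpa using hsupp
    by_contra! hne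
    have hli : LinearIndependent F ![x, y] := by
      rw [LinearIndependent.pair_iff' hx]
      intro a ha
      exact hne a (by rw [← ha, map_smul])
    obtain ⟨i, hxi, hyi⟩ := hP x y hli
    have h1 : e i ∈ Function.support (f y) := by simpa [f] using hyi
    have h2 := hsupp h1
    simp [f] at h2
    exact h2 hxi

/-- One of the two facts that make the unserved pairs a union of orbits. -/
theorem LinearIndependent.pair_smul_smul_add_smul {F V : Type*} [Field F] [AddCommGroup V]
    [Module F V] {x y : V} (h : LinearIndependent F ![x, y]) {s r : F} (hs : s ≠ 0) (hr : r ≠ 0)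
    (t : F) : LinearIndependent F ![s • x, r • y + t • x] := by
  rw [LinearIndependent.pair_iff] at h ⊢
  intro a b hab
  obtain ⟨h1, h2⟩ := h (a * s + b * t) (b * r) (by rw [← hab]; module)
  have hb : b = 0 := by simpa [hr] using h2
  subst hb
  simpa [hs] using h1

/-! ### Random lines over a field with more than two elements -/

section Lines

variable {F : Type*} [Field F]

/-- The `q + 1` points of the line spanned by two vectors. -/
def linePoint {V : Type*} [AddCommGroup V] [Module F V] (ab : V × V) : Option F → V
  | none => ab.2
  | some t => ab.1 + t • ab.2

/-- All points of the line through `ab` on which `x` vanishes are zeros of `y`. -/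
def LineFails {k : ℕ} (xy ab : (Fin k → F) × (Fin k → F)) : Prop :=
  ∀ o : Option F, xy.1 ⬝ᵥ linePoint ab o = 0 → xy.2 ⬝ᵥ linePoint ab o = 0

/-- If `x` is nonzero on the span of `a` and `b`, it vanishes at only one direction there, and a
functional vanishing on that direction is a multiple of `x`. -/
theorem LineFails.eq_zero_or_smul {k : ℕ} {x y a b : Fin k → F} (h : LineFails (x, y) (a, b)) :
    (x ⬝ᵥ a = 0 ∧ x ⬝ᵥ b = 0 ∧ y ⬝ᵥ a = 0 ∧ y ⬝ᵥ b = 0) ∨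
      ((x ⬝ᵥ a, x ⬝ᵥ b) ≠ 0 ∧ ∃ c, y ⬝ᵥ a = c * (x ⬝ᵥ a) ∧ y ⬝ᵥ b = c * (x ⬝ᵥ b)) := by
  have hn : x ⬝ᵥ b = 0 → y ⬝ᵥ b = 0 := h none
  have hs : ∀ t : F, x ⬝ᵥ a + t * (x ⬝ᵥ b) = 0 → y ⬝ᵥ a + t * (y ⬝ᵥ b) = 0 := fun t => by
    simpa [linePoint, dotProduct_add] using h (some t)
  generalize x ⬝ᵥ a = α at *
  generalize x ⬝ᵥ b = β at *
  generalize y ⬝ᵥ a = γ at *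
  generalize y ⬝ᵥ b = δ at *
  by_cases hβ : β = 0
  · subst hβ
    have hδ := hn rfl
    subst hδ
    by_cases hα : α = 0
    · subst hα
      left
      simpa using hs 0
    · right
      exact ⟨by simp [hα], γ / α, by field_simp, by simp⟩
  · right
    refine ⟨by simp [hβ], δ / β, ?_, by field_simp⟩
    -- `-α / β` parametrises the zero of `x` on the line.
    have := hs (-α / β) (by field_simp; ring)
    field_simp at this ⊢
    linear_combination this

open Classical in
theorem card_lineFails_le [Fintype F] {k : ℕ} {x y : Fin k → F}
    (h : LinearIndependent F ![x, y]) :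
    (Finset.univ.filter fun ab => LineFails (x, y) ab).card * Fintype.card F ^ 4
      ≤ (1 + (Fintype.card F ^ 2 - 1) * Fintype.card F)
        * Fintype.card ((Fin k → F) × (Fin k → F)) := by
  let g := (dotProductPair x y).prodMap (dotProductPair x y)
  have hg : Function.Surjective g :=
    (dotProductPair_surjective h).prodMap (dotProductPair_surjective h)
  let N : Finset (F × F) := Finset.univ.erase 0
  -- The bad values: both functionals zero on the line, or `x` nonzero and `y` one of its `q`
  -- multiples.
  let S : Finset ((F × F) × (F × F)) :=
    insert 0 ((N ×ˢ (Finset.univ : Finset F)).image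
      fun p => ((p.1.1, p.2 * p.1.1), (p.1.2, p.2 * p.1.2)))
  have hS : S.card ≤ 1 + (Fintype.card F ^ 2 - 1) * Fintype.card F := by
    refine (Finset.card_insert_le _ _).trans ?_
    rw [add_comm]
    gcongr
    refine Finset.card_image_le.trans ?_
    simp [N, Finset.card_erase_of_mem, sq]
  have hsub : (Finset.univ.filter fun ab => LineFails (x, y) ab)
      ⊆ Finset.univ.filter fun ab => g ab ∈ S := by
    rintro ⟨a, b⟩ hab
    simp only [Finset.mem_filter, Finset.mem_univ, true_and] at hab ⊢
    rcases hab.eq_zero_or_smul with ⟨h1, h2, h3, h4⟩ | ⟨hne, c, h1, h2⟩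
    · simp [g, S, dotProductPair, h1, h2, h3, h4]
    · refine Finset.mem_insert_of_mem (Finset.mem_image.2 ⟨((x ⬝ᵥ a, x ⬝ᵥ b), c), ?_, ?_⟩)
      · simpa [N] using hne
      · simp [g, dotProductPair, h1, h2]
  have hcard := card_filter_map_mem_mul_card g hg S
  have h4 : Fintype.card ((F × F) × (F × F)) = Fintype.card F ^ 4 := by
    simp only [Fintype.card_prod]; ring
  rw [h4] at hcard
  calc _ ≤ (Finset.univ.filter fun ab => g ab ∈ S).card * Fintype.card F ^ 4 := by gcongr
    _ = S.card * Fintype.card ((Fin k → F) × (Fin k → F)) := hcard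
    _ ≤ _ := by gcongr

theorem LineFails.smul_smul_add_smul {k : ℕ} {x y : Fin k → F} {ab : (Fin k → F) × (Fin k → F)}
    (h : LineFails (x, y) ab) {s : F} (hs : s ≠ 0) (r t : F) :
    LineFails (s • x, r • y + t • x) ab := by
  intro o ho
  have hx : x ⬝ᵥ linePoint ab o = 0 := by simpa [smul_dotProduct, hs] using ho
  have hy := h o hx
  simp only at hy
  simp [add_dotProduct, smul_dotProduct, hx, hy]

/-- `m` lines give a minimal code as soon as `p ^ m ≤ q ^ (-2 (k - 1))`, where
`p = (q³ - q + 1) / q⁴` bounds the probability that a random line fails. -/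
theorem lines_mem_minimalCodeLengths [Fintype F] {k m : ℕ} (hk : 2 ≤ k)
    (hq : 2 < Fintype.card F)
    (hm : (((Fintype.card F : ℝ) ^ 3 - Fintype.card F + 1) / (Fintype.card F : ℝ) ^ 4) ^ m
      * (Fintype.card F : ℝ) ^ (2 * k) ≤ (Fintype.card F : ℝ) ^ 2) :
    m * (Fintype.card F + 1) ∈ minimalCodeLengths F k := by
  classical
  set q := Fintype.card F with hqdef
  have hq3 : (3 : ℝ) ≤ q := by exact_mod_cast hq
  have hc : 0 ≤ ((q : ℝ) ^ 3 - q + 1) / (q : ℝ) ^ 4 := by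
    apply div_nonneg _ (by positivity)
    nlinarith [mul_nonneg (by linarith : (0 : ℝ) ≤ q) (by nlinarith : (0 : ℝ) ≤ (q : ℝ) ^ 2 - 1)]
  let X : Finset ((Fin k → F) × (Fin k → F)) :=
    Finset.univ.filter fun xy => LinearIndependent F ![xy.1, xy.2]
  have hX : (X.card : ℝ) ≤ (q : ℝ) ^ (2 * k) := by
    have : X.card ≤ q ^ (2 * k) := by
      refine (Finset.card_le_univ X).trans_eq ?_
      simp [← hqdef, two_mul, pow_add]
    exact_mod_cast this
  obtain ⟨w, hw⟩ := exists_choices_card_filter_le (LineFails (F := F) (k := k)) X hc (by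
    rintro ⟨x, y⟩ hxy
    have h := card_lineFails_le (Finset.mem_filter.1 hxy).2
    rw [← hqdef] at h
    have h' : ((Finset.univ.filter fun ab => LineFails (x, y) ab).card : ℝ) * (q : ℝ) ^ 4
        ≤ ((q : ℝ) ^ 3 - q + 1) * Fintype.card ((Fin k → F) × (Fin k → F)) := by
      have h1 : 1 ≤ q ^ 2 := Nat.one_le_pow _ _ (by omega)
      have := (Nat.cast_le (α := ℝ)).2 h
      push_cast [Nat.cast_sub h1] at this ⊢
      refine this.trans_eq ?_
      ring
    rw [div_mul_eq_mul_div, le_div_iff₀ (by positivity)]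
    exact h') m
  have hlt : ((X.filter fun x => ∀ i, LineFails x (w i)).card : ℝ) < (q - 1) ^ 2 * q := by
    calc _ ≤ _ := hw
      _ ≤ _ := mul_le_mul_of_nonneg_left hX (by positivity)
      _ ≤ (q : ℝ) ^ 2 := hm
      -- This needs `q ≥ 3`; it is false for `q = 2`.
      _ < (q - 1) ^ 2 * q := by nlinarith
  have hcard : Fintype.card (Fin m × Option F) = m * (q + 1) := by simp [hqdef]
  rw [← hcard]
  refine card_mem_minimalCodeLengths hk (fun i => linePoint (w i.1) i.2) ?_
  intro x y hxy
  by_contra! hno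
  have hfail : ∀ i, LineFails (x, y) (w i) := fun i o ho => hno (i, o) ho
  refine absurd hlt (not_lt.2 ?_)
  -- The orbit of one unserved pair already has `(q - 1)² q` elements.
  let φ : (Fˣ × Fˣ) × F → (Fin k → F) × (Fin k → F) :=
    fun p => ((p.1.1 : F) • x, (p.1.2 : F) • y + p.2 • x)
  have hφ : Function.Injective φ := by
    rintro ⟨⟨s, r⟩, t⟩ ⟨⟨s', r'⟩, t'⟩ heq
    simp only [φ, Prod.mk.injEq] at heq
    rw [LinearIndependent.pair_iff] at hxy
    have h1 := hxy (s - s') 0 (by rw [sub_smul, heq.1]; simp)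
    have h2 := hxy (t - t') (r - r') (by
      rw [sub_smul, sub_smul]
      have := heq.2
      linear_combination (exp := 1) this)
    simp only [Prod.mk.injEq, Units.ext_iff]
    exact ⟨⟨sub_eq_zero.1 h1.1, sub_eq_zero.1 h2.2⟩, sub_eq_zero.1 h2.1⟩
  have hsub : Finset.univ.image φ ⊆ X.filter fun x => ∀ i, LineFails x (w i) := by
    intro p hp
    obtain ⟨⟨⟨s, r⟩, t⟩, -, rfl⟩ := Finset.mem_image.1 hp
    simp only [X, φ, Finset.mem_filter, Finset.mem_univ, true_and]
    exact ⟨hxy.pair_smul_smul_add_smul s.ne_zero r.ne_zero t,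
      fun i => (hfail i).smul_smul_add_smul s.ne_zero _ _⟩
  have hle := Finset.card_le_card hsub
  rw [Finset.card_image_of_injective _ hφ, Finset.card_univ, Fintype.card_prod, Fintype.card_prod,
    Fintype.card_units, ← hqdef] at hle
  have := (Nat.cast_le (α := ℝ)).2 hle
  push_cast [Nat.cast_sub (by omega : 1 ≤ q)] at this
  linarith

end Lines

/-! ### Estimates for the number of lines -/

/-- Split off `1 / q` and use `1 - u ≤ exp (-u)` with `u = 1 / (q + 1)²`; what remains is `q² - q -
1 ≥ 0`. -/
theorem lineFail_ratio_le_exp {q : ℝ} (hq : 2 < q) :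
    (q ^ 3 - q + 1) / q ^ 4 ≤ Real.exp (-(Real.log q + 1 / (q + 1) ^ 2)) := by
  have hq0 : 0 < q := by linarith
  rw [neg_add, Real.exp_add, Real.exp_neg, Real.exp_log hq0]
  have h1 : 1 - 1 / (q + 1) ^ 2 ≤ Real.exp (-(1 / (q + 1) ^ 2)) := by
    linarith [Real.add_one_le_exp (-(1 / (q + 1) ^ 2))]
  have h2 : (q ^ 3 - q + 1) / q ^ 3 ≤ 1 - 1 / (q + 1) ^ 2 := by
    rw [div_le_iff₀ (by positivity), ← sub_nonneg]
    have : (1 - 1 / (q + 1) ^ 2) * q ^ 3 - (q ^ 3 - q + 1) = (q ^ 2 - q - 1) / (q + 1) ^ 2 := by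
      field_simp
      ring
    rw [this]
    exact div_nonneg (by nlinarith) (by positivity)
  calc (q ^ 3 - q + 1) / q ^ 4 = q⁻¹ * ((q ^ 3 - q + 1) / q ^ 3) := by field_simp
    _ ≤ _ := by gcongr; exact h2.trans h1

theorem lineFail_ratio_pow_mul_le {q : ℝ} (hq : 2 < q) {k m : ℕ}
    (hm : 2 / (1 + 1 / ((q + 1) ^ 2 * Real.log q)) * ((k : ℝ) - 1) ≤ m) :
    ((q ^ 3 - q + 1) / q ^ 4) ^ m * q ^ (2 * k) ≤ q ^ 2 := by
  have hq0 : 0 < q := by linarith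
  have hlog : 0 < Real.log q := Real.log_pos (by linarith)
  have hnum : 0 ≤ (q ^ 3 - q + 1) / q ^ 4 :=
    div_nonneg (by nlinarith [mul_pos hq0 (by nlinarith : 0 < q ^ 2 - 1)]) (by positivity)
  have hkm : 2 * ((k : ℝ) - 1) * Real.log q ≤ m * (Real.log q + 1 / (q + 1) ^ 2) := by
    have hpos : 0 < 1 + 1 / ((q + 1) ^ 2 * Real.log q) := by positivity
    rw [div_mul_eq_mul_div, div_le_iff₀ hpos] at hm
    calc 2 * ((k : ℝ) - 1) * Real.log q
        ≤ m * (1 + 1 / ((q + 1) ^ 2 * Real.log q)) * Real.log q := by gcongr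
      _ = _ := by field_simp
  have hpow : ∀ j : ℕ, q ^ j = Real.exp (j * Real.log q) := fun j => by
    rw [Real.exp_nat_mul, Real.exp_log hq0]
  calc ((q ^ 3 - q + 1) / q ^ 4) ^ m * q ^ (2 * k)
      ≤ Real.exp (-(Real.log q + 1 / (q + 1) ^ 2)) ^ m * q ^ (2 * k) := by
        gcongr; exact lineFail_ratio_le_exp hq
    _ = Real.exp (m * -(Real.log q + 1 / (q + 1) ^ 2) + (2 * k : ℕ) * Real.log q) := by
        rw [← Real.exp_nat_mul, hpow, ← Real.exp_add]
    _ ≤ Real.exp ((2 : ℕ) * Real.log q) := by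
        apply Real.exp_le_exp.2
        push_cast
        linarith
    _ = q ^ 2 := (hpow 2).symm

/-! ### Random points over the field with two elements -/

section Binary

variable {F : Type*} [Field F]

/-- The point `P` does not witness that the zeros of `x` are not all zeros of `y`. -/
def PointFails {k : ℕ} (xy : (Fin k → F) × (Fin k → F)) (P : Fin k → F) : Prop :=
  xy.1 ⬝ᵥ P = 0 → xy.2 ⬝ᵥ P = 0

open Classical in
theorem card_pointFails [Fintype F] (hF : Fintype.card F = 2) {k : ℕ} {x y : Fin k → F}
    (h : LinearIndependent F ![x, y]) :
    (Finset.univ.filter fun P => PointFails (x, y) P).card * 4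
      ≤ 3 * Fintype.card (Fin k → F) := by
  -- Over two elements, `(0, 1)` is the only pair of values that serves `(x, y)`.
  let S : Finset (F × F) := Finset.univ.erase (0, 1)
  have hS : S.card = 3 := by
    simp [S, Finset.card_erase_of_mem, hF]
  have hcard := card_filter_map_mem_mul_card _ (dotProductPair_surjective h) S
  rw [hS, Fintype.card_prod, hF] at hcard
  refine le_trans ?_ hcard.le
  norm_num
  refine Finset.card_le_card fun P hP => ?_
  simp only [Finset.mem_filter, Finset.mem_univ, true_and] at hP ⊢
  simp only [S, dotProductPair, AddMonoidHom.coe_mk, ZeroHom.coe_mk, Finset.mem_erase,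
    Finset.mem_univ, and_true, ne_eq, Prod.mk.injEq, not_and]
  intro hx hy
  have := hP hx
  simp [hy] at this

/-- With `n` points such that `(3/4)^n 4^k < 4`, at most one class of pairs of codewords is
bad, and one more point takes care of it. -/
theorem points_mem_minimalCodeLengths [Fintype F] (hF : Fintype.card F = 2) {k n : ℕ}
    (hk : 2 ≤ k) (hn : (3 / 4 : ℝ) ^ n * 4 ^ k < 4) : n + 1 ∈ minimalCodeLengths F k := by
  classical
  let X : Finset ((Fin k → F) × (Fin k → F)) :=
    Finset.univ.filter fun xy => LinearIndependent F ![xy.1, xy.2]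
  have hX : (X.card : ℝ) ≤ 4 ^ k := by
    have : X.card ≤ 4 ^ k := by
      refine (Finset.card_le_univ X).trans_eq ?_
      simp [hF, ← mul_pow]
    exact_mod_cast this
  obtain ⟨w, hw⟩ := exists_choices_card_filter_le (PointFails (F := F) (k := k)) X
    (c := 3 / 4) (by norm_num) (by
      rintro ⟨x, y⟩ hxy
      have h := card_pointFails hF (Finset.mem_filter.1 hxy).2
      have := (Nat.cast_le (α := ℝ)).2 h
      push_cast at this ⊢
      linarith) n
  set Y := X.filter fun x => ∀ i, PointFails x (w i) with hY
  have hYcard : Y.card < 4 := by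
    have : (Y.card : ℝ) < 4 := by
      calc _ ≤ _ := hw
        _ ≤ (3 / 4 : ℝ) ^ n * 4 ^ k := by gcongr
        _ < 4 := hn
    exact_mod_cast this
  have hadd : ∀ {x y}, (x, y) ∈ Y → (x, y + x) ∈ Y := by
    intro x y hxy
    simp only [hY, X, Finset.mem_filter, Finset.mem_univ, true_and] at hxy ⊢
    refine ⟨by simpa using hxy.1.pair_smul_smul_add_smul one_ne_zero one_ne_zero 1, fun i hx => ?_⟩
    have := hxy.2 i hx
    simp only at hx this
    simp [add_dotProduct, hx, this]
  have hne : ∀ {x y}, (x, y) ∈ Y → x ≠ 0 := by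
    intro x y hxy
    simp only [hY, X, Finset.mem_filter, Finset.mem_univ, true_and] at hxy
    simpa using hxy.1.ne_zero 0
  have h2 : ∀ z : Fin k → F, z + z = 0 := by
    intro z
    have : (2 : F) = 0 := by
      have := Nat.cast_card_eq_zero F
      rw [hF] at this
      exact_mod_cast this
    rw [← two_smul F, this, zero_smul]
  obtain ⟨P, hP⟩ : ∃ P : Fin k → F, ∀ x y, (x, y) ∈ Y → ¬ PointFails (x, y) P := by
    rcases Y.eq_empty_or_nonempty with hempty | ⟨⟨x, y⟩, hxy⟩
    · exact ⟨0, by simp [hempty]⟩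
    have hli : LinearIndependent F ![x, y] := by
      simp only [hY, X, Finset.mem_filter, Finset.mem_univ, true_and] at hxy
      exact hxy.1
    obtain ⟨P, hP⟩ := dotProductPair_surjective hli (0, 1)
    simp only [dotProductPair, AddMonoidHom.coe_mk, ZeroHom.coe_mk, Prod.mk.injEq] at hP
    refine ⟨P, fun x' y' hxy' hfail => ?_⟩
    -- A second orbit would bring `Y` to four elements.
    have hcases : (x', y') = (x, y) ∨ (x', y') = (x, y + x) := by
      by_contra! hcon
      have hsub : ({(x, y), (x, y + x), (x', y'), (x', y' + x')} :
          Finset ((Fin k → F) × (Fin k → F))) ⊆ Y := by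
        intro p hp
        simp only [Finset.mem_insert, Finset.mem_singleton] at hp
        rcases hp with rfl | rfl | rfl | rfl
        exacts [hxy, hadd hxy, hxy', hadd hxy']
      have hle := Finset.card_le_card hsub
      have hx0 := hne hxy
      have hx0' := hne hxy'
      obtain ⟨hc1, hc2⟩ := hcon
      rw [Finset.card_insert_of_notMem, Finset.card_insert_of_notMem, Finset.card_pair] at hle
      · omega
      · simpa using hx0'
      · simp only [Finset.mem_insert, Finset.mem_singleton, not_or]
        refine ⟨hc2.symm, fun h => hc1 ?_⟩
        simp only [Prod.mk.injEq] at h ⊢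
        obtain ⟨rfl, h⟩ := h
        exact ⟨rfl, (add_right_cancel h).symm⟩
      · simp only [Finset.mem_insert, Finset.mem_singleton, not_or]
        refine ⟨by simpa using hx0, hc1.symm, fun h => hc2 ?_⟩
        simp only [Prod.mk.injEq] at h ⊢
        obtain ⟨rfl, rfl⟩ := h
        exact ⟨rfl, by rw [add_assoc, h2, add_zero]⟩
    simp only [Prod.mk.injEq] at hcases
    rcases hcases with ⟨rfl, rfl⟩ | ⟨rfl, rfl⟩
    · have := hfail hP.1
      simp [hP.2] at this
    · have := hfail hP.1
      simp [add_dotProduct, hP.1, hP.2] at this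
  have hcard : Fintype.card (Fin (n + 1)) = n + 1 := by simp
  rw [← hcard]
  refine card_mem_minimalCodeLengths hk (Fin.cons P w) fun x y hxy => ?_
  by_contra! hno
  rw [Fin.forall_fin_succ] at hno
  refine hP x y ?_ (by simpa [PointFails] using hno.1)
  simp only [hY, X, Finset.mem_filter, Finset.mem_univ, true_and]
  exact ⟨hxy, fun i => by simpa [PointFails] using hno.2 i⟩

end Binary

/-! ### Dimension one, the binary numerics and the final bounds -/

theorem one_mem_minimalCodeLengths_one (F : Type*) [Field F] : 1 ∈ minimalCodeLengths F 1 := by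
  refine ⟨⊤, by simp, fun c _ => ⟨Submodule.mem_top, fun c' _ hsupp => ?_⟩⟩
  by_cases hc : c 0 = 0
  · refine ⟨0, ?_⟩
    ext i
    obtain rfl : i = 0 := Subsingleton.elim _ _
    by_contra h
    exact hsupp (by simpa using h) hc
  · refine ⟨c' 0 / c 0, ?_⟩
    ext i
    obtain rfl : i = 0 := Subsingleton.elim _ _
    simp [hc]

theorem logb_two_four_thirds_pos : 0 < Real.logb 2 (4 / 3) :=
  Real.logb_pos (by norm_num) (by norm_num)

theorem logb_two_four_thirds_le_one : Real.logb 2 (4 / 3) ≤ 1 := by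
  rw [Real.logb_le_iff_le_rpow (by norm_num) (by norm_num)]
  norm_num

/-- Exponentiating the hypothesis gives `(3/4)^n * 4^k < 32/9`, so the `-1` in the numerator pays
for the extra point. -/
theorem three_quarters_pow_mul_lt {k n : ℕ}
    (hn : (2 * (k : ℝ) - 1) / Real.logb 2 (4 / 3) < n + 2) : (3 / 4 : ℝ) ^ n * 4 ^ k < 4 := by
  rw [div_lt_iff₀ logb_two_four_thirds_pos] at hn
  have h43 : (2 : ℝ) ^ Real.logb 2 (4 / 3) = 4 / 3 :=
    Real.rpow_logb (by norm_num) (by norm_num) (by norm_num)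
  have h := Real.rpow_lt_rpow_of_exponent_lt (one_lt_two : (1 : ℝ) < 2) hn
  have hl : (2 : ℝ) ^ (2 * (k : ℝ) - 1) = 4 ^ k / 2 := by
    rw [Real.rpow_sub (by norm_num), Real.rpow_mul (by norm_num), Real.rpow_one,
      Real.rpow_natCast]
    norm_num
  have hr : (2 : ℝ) ^ (((n : ℝ) + 2) * Real.logb 2 (4 / 3)) = (4 / 3) ^ n * (16 / 9) := by
    rw [mul_comm, Real.rpow_mul (by norm_num), h43, Real.rpow_add (by norm_num),
      Real.rpow_natCast]
    norm_num
  rw [hl, hr] at h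
  have hone : (3 / 4 : ℝ) ^ n * (4 / 3) ^ n = 1 := by
    rw [← mul_pow]; norm_num
  have hpos : (0 : ℝ) < (3 / 4) ^ n := by positivity
  nlinarith [mul_lt_mul_of_pos_left h hpos]

theorem mainTheorem1 {F : Type*} [Field F] [Fintype F] (q : ℕ) (hF : Fintype.card F = q)
    (k : ℕ) :
    (2 < q → 2 ≤ k →
      (minimalCodeLengths F k).Nonempty ∧
      (minLength F k : ℝ) ≤
        (⌈2 / (1 + 1 / (((q : ℝ) + 1) ^ 2 * Real.log (q : ℝ))) * ((k : ℝ) - 1)⌉ : ℝ)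
          * ((q : ℝ) + 1)) ∧
    (q = 2 → 1 ≤ k →
      (minimalCodeLengths F k).Nonempty ∧
      (minLength F k : ℝ) ≤ (2 * (k : ℝ) - 1) / Real.logb 2 (4 / 3)) := by
  subst hF
  constructor
  · intro hq hk
    set y := 2 / (1 + 1 / (((Fintype.card F : ℝ) + 1) ^ 2 * Real.log (Fintype.card F : ℝ)))
      * ((k : ℝ) - 1) with hy
    have hq' : (2 : ℝ) < Fintype.card F := by exact_mod_cast hq
    have hk' : (2 : ℝ) ≤ k := by exact_mod_cast hk
    have hy0 : 0 ≤ y := by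
      have : 0 ≤ Real.log (Fintype.card F : ℝ) := Real.log_nonneg (by linarith)
      have : (0 : ℝ) ≤ (k : ℝ) - 1 := by linarith
      positivity
    have hmem := lines_mem_minimalCodeLengths hk hq
      (lineFail_ratio_pow_mul_le hq' (hy ▸ Nat.le_ceil y))
    refine ⟨⟨_, hmem⟩, ?_⟩
    have hle : (minLength F k : ℝ) ≤ (⌈y⌉₊ * (Fintype.card F + 1) : ℕ) :=
      Nat.cast_le.2 (Nat.sInf_le hmem)
    have hceil : ((⌈y⌉₊ : ℕ) : ℝ) = ((⌈y⌉ : ℤ) : ℝ) := natCast_ceil_eq_intCast_ceil hy0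
    push_cast at hle
    rwa [hceil] at hle
  · intro hq hk
    set y := (2 * (k : ℝ) - 1) / Real.logb 2 (4 / 3) with hy
    have hk' : (1 : ℝ) ≤ k := by exact_mod_cast hk
    have hy1 : 1 ≤ y := by
      rw [hy, le_div_iff₀ logb_two_four_thirds_pos]
      linarith [logb_two_four_thirds_le_one]
    suffices h : ∃ n ∈ minimalCodeLengths F k, (n : ℝ) ≤ y by
      obtain ⟨n, hn, hny⟩ := h
      refine ⟨⟨n, hn⟩, le_trans ?_ hny⟩
      exact_mod_cast Nat.sInf_le hn
    rcases hk.eq_or_lt with rfl | hk2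
    · exact ⟨1, one_mem_minimalCodeLengths_one F, by simpa using hy1⟩
    -- The length is `⌊y⌋₊`: `n` averaged points and one for repair, with `y < n + 2`.
    obtain ⟨n, hn⟩ : ∃ n, ⌊y⌋₊ = n + 1 :=
      Nat.exists_eq_add_of_le' (Nat.le_floor (by simpa using hy1))
    refine ⟨n + 1, points_mem_minimalCodeLengths hq hk2 (three_quarters_pow_mul_lt ?_), ?_⟩
    · have := Nat.lt_floor_add_one y
      rw [hn] at this
      push_cast at this
      linarith
    · rw [← hn]
      exact Nat.floor_le (by linarith)
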